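/- Let $N\ge 1$ and $\ell,m\in\{0,1,2,\dots\}$ be integers, let $T_*\in(0,\infty]$, $L>0$ and $d>\ell+m$, and let $G=G(x,y,t)$ be a real-valued function on $\mathbb R^N\times\mathbb R^N\times(0,T_*)$ satisfying condition (G): * $G\in C^{\ell+m}(\mathbb R^{2N}\times(0,T_*))$; * there is $C_G>0$ such that $$|\nabla_x^jG(x,y,t)|\le C_G\,t^{-\frac{N+j}{d}}\bigl(1+t^{-\frac1d}|x-y|\bigr)^{-N-L-j}$$ for all $x,y\in\mathbb R^N$, $t\in(0,T_*)$ and $j\in\{0,\dots,\ell+m\}$; * $G(x,z,t)=\int_{\mathbb R^N}G(x,y,t-s)\,G(y,z,s)\,dy$ for all $x,z\in\mathbb R^N$ and $0<s<t<T_*$. Here $|\nabla_x^jG|$ is the Euclidean norm of the $N^j$-tuple of all partial derivatives of $G$ of order $j$ in $x$. Let $0<\theta<2$ with $\theta\le\min\{d,L\}$, let $$P_\theta(x,t)=(2\pi)^{-N}\int_{\mathbb R^N}e^{ix\cdot\xi}e^{-t|\xi|^\theta}\,d\xi,\qquad x\in\mathbb R^N,\ t>0,$$ be the fundamental solution of the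 fractional heat equation $\partial_tu+(-\Delta)^{\theta/2}u=0$ in $\mathbb R^N\times(0,\infty)$, and set $K_\theta(x,t):=P_\theta(x,t^{\theta/d})$ for $x\in\mathbb R^N$, $t>0$. Then: (a) For every $j\in\{0,\dots,\ell+m\}$ there exists $c_j>0$ such that $$|\nabla_x^jG(x,y,t)|\le c_j\,t^{-\frac jd}K_\theta(x-y,t)\qquad\text{for all }x,y\in\mathbb R^N,\ t\in(0,T_*).$$ (b) There exists $C_*>0$ such that, for all $x\in\mathbb R^N$ and $0<s<t$, the function $y\mapsto K_\theta(x-y,t-s)K_\theta(y,s)$ is integrable on $\mathbb R^N$ and $$\int_{\mathbb R^N}K_\theta(x-y,t-s)\,K_\theta(y,s)\,dy\le C_*K_\theta(x,t).$$ -/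

import Mathlib

open MeasureTheory

noncomputable section

/-- The Euclidean length `|∇ʲ f(x)|` of the tensor `(∂_{i₁} ⋯ ∂_{iⱼ} f(x))`, indexed by
`(i₁, …, iⱼ) ∈ {1, …, N}ʲ`, of all partial derivatives of order `j` of `f` at `x`. -/
def gradNorm {N : ℕ} (j : ℕ) (f : EuclideanSpace ℝ (Fin N) → ℝ)
    (x : EuclideanSpace ℝ (Fin N)) : ℝ :=
  Real.sqrt (∑ i : Fin j → Fin N,
    (iteratedFDeriv ℝ j f x (fun k => EuclideanSpace.single (i k) (1 : ℝ))) ^ 2)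

/-- Condition (G) on an integral kernel `G = G(x, y, t)` on `ℝᴺ × ℝᴺ × (0, T)`, `T ∈ (0, ∞]`. -/
structure ConditionG {N : ℕ} (ℓ m : ℕ) (d L : ℝ) (T : EReal)
    (G : EuclideanSpace ℝ (Fin N) → EuclideanSpace ℝ (Fin N) → ℝ → ℝ) : Prop where
  T_pos : 0 < T
  lt_d : ((ℓ + m : ℕ) : ℝ) < d
  L_pos : 0 < L
  contDiffOn : ContDiffOn ℝ ((ℓ + m : ℕ) : WithTop ℕ∞)
    (fun p : EuclideanSpace ℝ (Fin N) × EuclideanSpace ℝ (Fin N) × ℝ => G p.1 p.2.1 p.2.2)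
    {p | 0 < p.2.2 ∧ (p.2.2 : EReal) < T}
  bound : ∃ C : ℝ, 0 < C ∧ ∀ j : ℕ, j ≤ ℓ + m →
    ∀ (x y : EuclideanSpace ℝ (Fin N)) (t : ℝ), 0 < t → (t : EReal) < T →
      gradNorm j (fun z => G z y t) x ≤
        C * t ^ (-((N + j : ℝ) / d)) * (1 + t ^ (-(1 / d)) * ‖x - y‖) ^ (-(N : ℝ) - L - j)
  semigroup : ∀ (x z : EuclideanSpace ℝ (Fin N)) (s t : ℝ), 0 < s → s < t → (t : EReal) < T →
    G x z t = ∫ y, G x y (t - s) * G y z s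

/-- The Fourier integral `(2π)⁻ᴺ ∫ exp(i x·ξ) exp(-t |ξ|^θ) dξ`. -/
def fracHeatKernelC {N : ℕ} (θ : ℝ) (x : EuclideanSpace ℝ (Fin N)) (t : ℝ) : ℂ :=
  (((2 * Real.pi) ^ N)⁻¹ : ℝ) * ∫ ξ : EuclideanSpace ℝ (Fin N),
    Complex.exp (Complex.I * (inner ℝ x ξ : ℝ)) * (Real.exp (-t * ‖ξ‖ ^ θ) : ℝ)

/-- The fundamental solution `P_θ(x, t) = (2π)⁻ᴺ ∫ exp(i x·ξ) exp(-t |ξ|^θ) dξ` of the fractional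
heat equation `∂ₜ u + (-Δ)^{θ/2} u = 0` on `ℝᴺ`. The integral is real
(`ofReal_fracHeatKernel`), so nothing is lost by taking its real part. -/
def fracHeatKernel {N : ℕ} (θ : ℝ) (x : EuclideanSpace ℝ (Fin N)) (t : ℝ) : ℝ :=
  (fracHeatKernelC θ x t).re

theorem ofReal_fracHeatKernel {N : ℕ} (θ : ℝ) (x : EuclideanSpace ℝ (Fin N)) (t : ℝ) :
    (fracHeatKernel θ x t : ℂ) = fracHeatKernelC θ x t := by
  rw [fracHeatKernel, ← Complex.conj_eq_iff_re, fracHeatKernelC, map_mul, Complex.conj_ofReal,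
    ← integral_conj]
  congr 1
  rw [← integral_neg_eq_self]
  congr 1
  ext ξ
  simp [← Complex.exp_conj]

/-- The kernel `K_θ(x, t) = P_θ(x, t^{θ/d})`. -/
def majorantKernel {N : ℕ} (d θ : ℝ) (x : EuclideanSpace ℝ (Fin N)) (t : ℝ) : ℝ :=
  fracHeatKernel θ x (t ^ (θ / d))

end

/-! Everything rests on K_θ(x,t) ≍ ρ^θ (ρ+|x|)^{-N-θ} with ρ = t^{1/d} (`majorantKernel_bounds`).
Given this, (a) is a comparison of exponents, since θ ≤ L. For (b), ρ+|x| at time t is controlled by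
the same quantity for one of the two factors, so that factor is dominated by the profile at (x,t),
while the other has an integral independent of its scale.

Scaling reduces the two-sided bound to P_θ(·,1), which is a mixture of Gaussians: e^{-|ξ|^θ} is the
Laplace transform at |ξ|² of a one-sided stable law ν of index α = θ/2
(`exists_stable_subordinator`), and Fubini gives P_θ(x,1) = const · ∫ u^{-N/2} e^{-|x|²/4u} dν(u).
No density of ν is used: the integrand is compared, above and below, with combinations of 1 -
e^{-au}, whose ν-integrals are explicit (`integral_gaussian_stable_bounds`).

The law ν is a limit of rescaled sums of Pareto variables. The map u ↦ e^{-u} carries (0,∞) into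
[0,1], turning Laplace transforms into moments and making compactness immediate. -/

open MeasureTheory Filter Topology Set

/-! ### Construction of the one-sided stable law. -/

/-- If the moments `a ↦ E[Vₙ ^ a]` of random variables `Vₙ` in `[0, 1]` converge pointwise, the limit
is again the moment function of a random variable in `[0, 1]`. -/
theorem exists_moments_eq_of_tendsto (ρ : ℕ → ProbabilityMeasure unitInterval) (φ : ℝ → ℝ)
    (h : ∀ a : ℝ, 0 < a →
      Tendsto (fun n => ∫ v, (v : ℝ) ^ a ∂(ρ n : Measure unitInterval)) atTop (𝓝 (φ a))) :
    ∃ μ : ProbabilityMeasure unitInterval,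
      ∀ a : ℝ, 0 < a → ∫ v, (v : ℝ) ^ a ∂(μ : Measure unitInterval) = φ a := by
  -- Compactness gives a limit along an ultrafilter finer than `atTop`; no subsequence is needed,
  -- because the moments already converge along `atTop`.
  obtain ⟨μ, -, hμ⟩ := isCompact_iff_ultrafilter_le_nhds.1
    (isCompact_univ (X := ProbabilityMeasure unitInterval))
    ((Ultrafilter.of (atTop : Filter ℕ)).map ρ) (by simp)
  refine ⟨μ, fun a ha => ?_⟩
  have h1 : Tendsto ρ ((Ultrafilter.of (atTop : Filter ℕ) : Ultrafilter ℕ) : Filter ℕ) (𝓝 μ) := hμ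
  rw [ProbabilityMeasure.tendsto_iff_forall_integral_tendsto] at h1
  have h2 := h1 (BoundedContinuousFunction.mkOfCompact
    ⟨fun v : unitInterval => (v : ℝ) ^ a, by
      exact continuous_subtype_val.rpow_const fun _ => Or.inr ha.le⟩)
  exact tendsto_nhds_unique h2 ((h a ha).mono_left (Ultrafilter.of_le _))

/-- The `n`-fold product of independent copies multiplies moments. -/
theorem exists_moments_eq_pow (ρ : ProbabilityMeasure unitInterval) (n : ℕ) :
    ∃ μ : ProbabilityMeasure unitInterval, ∀ a : ℝ,
      ∫ v, (v : ℝ) ^ a ∂(μ : Measure unitInterval) =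
        (∫ v, (v : ℝ) ^ a ∂(ρ : Measure unitInterval)) ^ n := by
  have hm : Measurable fun x : Fin n → unitInterval => ∏ i, x i := by fun_prop
  have hp : IsProbabilityMeasure
      ((Measure.pi fun _ : Fin n => (ρ : Measure unitInterval)).map fun x => ∏ i, x i) :=
    Measure.isProbabilityMeasure_map hm.aemeasurable
  refine ⟨⟨_, hp⟩, fun a => ?_⟩
  rw [ProbabilityMeasure.coe_mk, integral_map hm.aemeasurable]
  · have := integral_fintype_prod_eq_pow (ι := Fin n) (μ := (ρ : Measure unitInterval))
      (fun v : unitInterval => (v : ℝ) ^ a)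
    rw [Fintype.card_fin] at this
    rw [← this]
    congr 1
    ext x
    rw [Real.finsetProd_rpow _ _ fun i _ => (x i).2.1]
    congr 1
    exact map_prod unitInterval.submonoid.subtype x Finset.univ
  · exact (measurable_subtype_coe.pow_const a).aestronglyMeasurable

/-- Near 0 the integrand is at most α w^{-α}, integrable since α < 1; at infinity it is at most α
w^{-1-α}, integrable since α > 0. -/
theorem integrableOn_one_sub_exp_mul_rpow {α : ℝ} (h0 : 0 < α) (h1 : α < 1) :
    IntegrableOn (fun w : ℝ => (1 - Real.exp (-w)) * (α * w ^ (-1 - α))) (Ioi 0) := by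
  have hmeas : Measurable fun w : ℝ => (1 - Real.exp (-w)) * (α * w ^ (-1 - α)) := by fun_prop
  rw [← Ioc_union_Ioi_eq_Ioi (zero_le_one' ℝ)]
  refine IntegrableOn.union ?_ ?_
  · have : IntegrableOn (fun w : ℝ => α * w ^ (-α)) (Ioc 0 1) :=
      ((intervalIntegrable_iff_integrableOn_Ioc_of_le zero_le_one).1
        (intervalIntegral.intervalIntegrable_rpow' (by linarith))).const_mul α
    refine this.mono' hmeas.aestronglyMeasurable ?_
    refine (ae_restrict_iff' measurableSet_Ioc).2 (ae_of_all _ fun w hw => ?_)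
    have h2 : Real.exp (-w) ≤ 1 := Real.exp_le_one_iff.2 (by linarith [hw.1])
    have h3 := Real.add_one_le_exp (-w)
    have h4 : 0 < w ^ (-1 - α) := Real.rpow_pos_of_pos hw.1 _
    rw [Real.norm_of_nonneg (mul_nonneg (by linarith) (by positivity))]
    calc _ ≤ w * (α * w ^ (-1 - α)) := by gcongr; linarith
      _ = α * (w ^ (1 : ℝ) * w ^ (-1 - α)) := by rw [Real.rpow_one]; ring
      _ = _ := by rw [← Real.rpow_add hw.1]; congr 2; ring
  · have : IntegrableOn (fun w : ℝ => α * w ^ (-1 - α)) (Ioi 1) :=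
      (integrableOn_Ioi_rpow_of_lt (by linarith) one_pos).const_mul α
    refine this.mono' hmeas.aestronglyMeasurable ?_
    refine (ae_restrict_iff' measurableSet_Ioi).2 (ae_of_all _ fun w hw => ?_)
    have hw0 : 0 < w := one_pos.trans hw
    have h2 : Real.exp (-w) ≤ 1 := Real.exp_le_one_iff.2 (by linarith)
    have h4 : 0 < w ^ (-1 - α) := Real.rpow_pos_of_pos hw0 _
    rw [Real.norm_of_nonneg (mul_nonneg (by linarith) (by positivity))]
    exact mul_le_of_le_one_left (by positivity) (by linarith [Real.exp_pos (-w)])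

theorem integral_one_sub_exp_mul_rpow_pos {α : ℝ} (h0 : 0 < α) (h1 : α < 1) :
    0 < ∫ w in Ioi (0 : ℝ), (1 - Real.exp (-w)) * (α * w ^ (-1 - α)) := by
  have hpos : ∀ w ∈ Ioi (0 : ℝ), 0 < (1 - Real.exp (-w)) * (α * w ^ (-1 - α)) := fun w hw =>
    mul_pos (sub_pos.2 (Real.exp_lt_one_iff.2 (neg_lt_zero.2 hw)))
      (mul_pos h0 (Real.rpow_pos_of_pos hw _))
  rw [setIntegral_pos_iff_support_of_nonneg_ae
    ((ae_restrict_iff' measurableSet_Ioi).2 (ae_of_all _ fun w hw => (hpos w hw).le))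
    (integrableOn_one_sub_exp_mul_rpow h0 h1)]
  rw [inter_eq_self_of_subset_right (s := Function.support _) fun w hw => (hpos w hw).ne']
  simp

/-- The Laplace transform of the Pareto distribution with exponent `α`. -/
theorem exists_pareto {α : ℝ} (h0 : 0 < α) (h1 : α < 1) :
    ∃ ρ : Measure ℝ, IsProbabilityMeasure ρ ∧ (∀ᵐ u ∂ρ, 0 < u) ∧ ∀ a : ℝ, 0 < a →
      ∫ u, Real.exp (-(a * u)) ∂ρ =
        1 - a ^ α * ∫ w in Ioi a, (1 - Real.exp (-w)) * (α * w ^ (-1 - α)) := by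
  have hd : Measurable fun u : ℝ => ENNReal.ofReal (α * u ^ (-1 - α)) := by fun_prop
  have hnn : ∀ u ∈ Ioi (1 : ℝ), 0 ≤ α * u ^ (-1 - α) := fun u hu =>
    mul_nonneg h0.le (Real.rpow_nonneg (zero_le_one.trans (le_of_lt hu)) _)
  have hi : IntegrableOn (fun w : ℝ => α * w ^ (-1 - α)) (Ioi 1) :=
    (integrableOn_Ioi_rpow_of_lt (by linarith) one_pos).const_mul α
  have htot : ∫ w in Ioi (1 : ℝ), α * w ^ (-1 - α) = 1 := by
    rw [integral_const_mul, integral_Ioi_rpow_of_lt (by linarith) one_pos, Real.one_rpow]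
    have : -1 - α + 1 = -α := by ring
    rw [this]
    field_simp
  have hprob : IsProbabilityMeasure ((volume.restrict (Ioi (1 : ℝ))).withDensity
      fun u : ℝ => ENNReal.ofReal (α * u ^ (-1 - α))) := by
    constructor
    rw [withDensity_apply _ MeasurableSet.univ, Measure.restrict_univ,
      ← ofReal_integral_eq_lintegral_ofReal hi
        ((ae_restrict_iff' measurableSet_Ioi).2 (ae_of_all _ hnn)), htot, ENNReal.ofReal_one]
  refine ⟨_, hprob, ?_, fun a ha => ?_⟩
  · refine (withDensity_absolutelyContinuous _ _).ae_le ?_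
    exact (ae_restrict_iff' measurableSet_Ioi).2 (ae_of_all _ fun w hw => one_pos.trans hw)
  · have hint : Integrable (fun u : ℝ => Real.exp (-(a * u)) * (α * u ^ (-1 - α)))
        (volume.restrict (Ioi 1)) := by
      refine hi.mono' (by fun_prop) ?_
      refine (ae_restrict_iff' measurableSet_Ioi).2 (ae_of_all _ fun w hw => ?_)
      have hw0 : 0 < w := one_pos.trans hw
      have := hnn w hw
      rw [Real.norm_of_nonneg (by positivity)]
      exact mul_le_of_le_one_left this (Real.exp_le_one_iff.2 (by nlinarith))
    rw [integral_withDensity_eq_integral_toReal_smul hd (ae_of_all _ fun _ => ENNReal.ofReal_lt_top)]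
    have e1 : ∫ u in Ioi (1 : ℝ), (ENNReal.ofReal (α * u ^ (-1 - α))).toReal • Real.exp (-(a * u)) =
        ∫ u in Ioi (1 : ℝ), Real.exp (-(a * u)) * (α * u ^ (-1 - α)) :=
      setIntegral_congr_fun measurableSet_Ioi fun u hu => by
        simp only [smul_eq_mul]
        rw [ENNReal.toReal_ofReal (hnn u hu), mul_comm]
    -- Substitution w = a u: the powers of a collect to a^{-α}, which cancels the prefactor a^α.
    have e2 : ∫ w in Ioi a, (1 - Real.exp (-w)) * (α * w ^ (-1 - α)) =
        a * ∫ u in Ioi (1 : ℝ), (1 - Real.exp (-(a * u))) * (α * (a * u) ^ (-1 - α)) := by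
      rw [integral_comp_mul_left_Ioi (fun w => (1 - Real.exp (-w)) * (α * w ^ (-1 - α))) 1 ha,
        mul_one, smul_eq_mul, mul_inv_cancel_left₀ ha.ne']
    have e3 : ∫ u in Ioi (1 : ℝ), (1 - Real.exp (-(a * u))) * (α * (a * u) ^ (-1 - α)) =
        a ^ (-1 - α) * ∫ u in Ioi (1 : ℝ), (1 - Real.exp (-(a * u))) * (α * u ^ (-1 - α)) := by
      rw [← integral_const_mul]
      refine setIntegral_congr_fun measurableSet_Ioi fun u hu => ?_
      rw [Real.mul_rpow ha.le (zero_le_one.trans (le_of_lt hu))]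
      ring
    have e4 : ∫ u in Ioi (1 : ℝ), (1 - Real.exp (-(a * u))) * (α * u ^ (-1 - α)) =
        1 - ∫ u in Ioi (1 : ℝ), Real.exp (-(a * u)) * (α * u ^ (-1 - α)) := by
      refine Eq.trans ?_ ((integral_sub hi hint).trans (by rw [htot]))
      congr 1
      ext u
      ring
    have e5 : a ^ α * (a * (a ^ (-1 - α))) = 1 := by
      nth_rewrite 2 [← Real.rpow_one a]
      rw [← Real.rpow_add ha, ← Real.rpow_add ha]
      rw [show α + (1 + (-1 - α)) = 0 by ring, Real.rpow_zero]
    rw [e1, e2, e3, e4]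
    linear_combination (1 - ∫ u in Ioi (1 : ℝ), Real.exp (-(a * u)) * (α * u ^ (-1 - α))) * e5

/-- Stable limit theorem in multiplicative form: the product of n independent copies of e^{-κ_n U},
with U Pareto, has a-th moment (1 - (aκ_n)^α I(aκ_n))^n, which tends to exp(-a^α). -/
theorem exists_moments_eq_exp {α : ℝ} (h0 : 0 < α) (h1 : α < 1) :
    ∃ μ : ProbabilityMeasure unitInterval, ∀ a : ℝ, 0 < a →
      ∫ v, (v : ℝ) ^ a ∂(μ : Measure unitInterval) = Real.exp (-a ^ α) := by
  obtain ⟨ρ, hρ, hρ0, hL⟩ := exists_pareto h0 h1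
  set I : ℝ → ℝ := fun a => ∫ w in Ioi a, (1 - Real.exp (-w)) * (α * w ^ (-1 - α)) with hI
  have hc : 0 < I 0 := integral_one_sub_exp_mul_rpow_pos h0 h1
  have hIlim : ∀ b : ℕ → ℝ, (∀ n, 0 ≤ b n) → Tendsto b atTop (𝓝 0) →
      Tendsto (fun n => I (b n)) atTop (𝓝 (I 0)) := by
    intro b hb hb0
    have hint := integrableOn_one_sub_exp_mul_rpow h0 h1
    have e : ∀ n, I (b n) = ∫ w in Ioi (0 : ℝ), (Ioi (b n)).indicator
        (fun w => (1 - Real.exp (-w)) * (α * w ^ (-1 - α))) w := fun n => by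
      rw [integral_indicator measurableSet_Ioi, Measure.restrict_restrict measurableSet_Ioi,
        inter_eq_self_of_subset_left (Ioi_subset_Ioi (hb n))]
    simp_rw [e]
    refine tendsto_integral_of_dominated_convergence _ (fun n => ?_) hint.norm (fun n => ?_) ?_
    · exact hint.aestronglyMeasurable.indicator measurableSet_Ioi
    · exact ae_of_all _ fun w => norm_indicator_le_norm_self _ _
    · refine (ae_restrict_iff' measurableSet_Ioi).2 (ae_of_all _ fun w hw => ?_)
      refine tendsto_const_nhds.congr' ?_
      filter_upwards [hb0.eventually_lt_const hw] with n hn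
      rw [indicator_of_mem (by exact hn)]
  -- scale of the `n`-th summand
  set κ : ℕ → ℝ := fun n => ((n : ℝ) * I 0) ^ (-(1 / α)) with hκ
  have hκ0 : ∀ n, 0 ≤ κ n := fun n => by positivity
  have hκlim : Tendsto κ atTop (𝓝 0) :=
    (tendsto_rpow_neg_atTop (by positivity)).comp
      (tendsto_natCast_atTop_atTop.atTop_mul_const hc)
  -- The projection only supplies the type: for u > 0 the exponential already lies in [0,1].
  let f : ℕ → ℝ → unitInterval := fun n u => projIcc 0 1 zero_le_one (Real.exp (-(κ n * u)))
  have hf : ∀ n, Measurable (f n) := fun n =>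
    (continuous_projIcc.comp (by fun_prop)).measurable
  have hp : ∀ n, IsProbabilityMeasure (ρ.map (f n)) := fun n =>
    Measure.isProbabilityMeasure_map (hf n).aemeasurable
  choose μ hμ using fun n => exists_moments_eq_pow ⟨ρ.map (f n), hp n⟩ n
  refine exists_moments_eq_of_tendsto μ _ fun a ha => ?_
  have hmom : ∀ n : ℕ, 0 < n → ∫ v, (v : ℝ) ^ a ∂(μ n : Measure unitInterval) =
      (1 + -((a * κ n) ^ α * I (a * κ n))) ^ n := by
    intro n hn
    have hκpos : 0 < κ n := by positivity
    rw [hμ, ProbabilityMeasure.coe_mk, integral_map (hf n).aemeasurable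
      (measurable_subtype_coe.pow_const a).aestronglyMeasurable, ← sub_eq_add_neg,
      ← hL _ (mul_pos ha hκpos)]
    congr 1
    refine integral_congr_ae ?_
    filter_upwards [hρ0] with u hu
    have : (f n u : ℝ) = Real.exp (-(κ n * u)) := by
      simp only [f]
      rw [projIcc_of_mem zero_le_one ⟨(Real.exp_pos _).le, Real.exp_le_one_iff.2 (by
        have := mul_nonneg (hκ0 n) hu.le; linarith)⟩]
    rw [this, ← Real.exp_mul]
    congr 1
    ring
  -- The choice of κ gives n (aκ_n)^α = a^α / I 0, and I (aκ_n) → I 0.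
  have hlim : Tendsto (fun n : ℕ => (1 + -((a * κ n) ^ α * I (a * κ n))) ^ n) atTop
      (𝓝 (Real.exp (-a ^ α))) := by
    apply Real.tendsto_one_add_pow_exp_of_tendsto
    have h2 : Tendsto (fun n => -(a ^ α * (I 0)⁻¹ * I (a * κ n))) atTop
        (𝓝 (-(a ^ α * (I 0)⁻¹ * I 0))) :=
      ((hIlim _ (fun n => mul_nonneg ha.le (hκ0 n))
        (by simpa using hκlim.const_mul a)).const_mul _).neg
    rw [inv_mul_cancel_right₀ hc.ne'] at h2
    refine h2.congr' ?_
    filter_upwards [eventually_gt_atTop 0] with n hn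
    have hn' : (0 : ℝ) < n := by exact_mod_cast hn
    have : κ n ^ α = ((n : ℝ) * I 0)⁻¹ := by
      rw [hκ]
      simp only
      rw [← Real.rpow_mul (by positivity), neg_mul, one_div, inv_mul_cancel₀ h0.ne',
        Real.rpow_neg_one]
    rw [Real.mul_rpow ha.le (hκ0 n), this]
    field_simp
  refine hlim.congr' ?_
  filter_upwards [eventually_gt_atTop 0] with n hn
  exact (hmom n hn).symm

/-- The one-sided stable law of index `α ∈ (0, 1)`, given by its Laplace transform. -/
theorem exists_stable_subordinator {α : ℝ} (h0 : 0 < α) (h1 : α < 1) :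
    ∃ ν : Measure ℝ, IsProbabilityMeasure ν ∧ (∀ᵐ u ∂ν, 0 < u) ∧ ∀ a : ℝ, 0 ≤ a →
      ∫ u, Real.exp (-(a * u)) ∂ν = Real.exp (-a ^ α) := by
  obtain ⟨μ, hμ⟩ := exists_moments_eq_exp h0 h1
  have hcont : ∀ a : ℝ, 0 ≤ a → Integrable (fun v : unitInterval => (v : ℝ) ^ a)
      (μ : Measure unitInterval) := fun a ha => by
    refine Integrable.of_bound (measurable_subtype_coe.pow_const a).aestronglyMeasurable 1 ?_
    refine ae_of_all _ fun v => ?_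
    rw [Real.norm_of_nonneg (Real.rpow_nonneg v.2.1 _)]
    exact Real.rpow_le_one v.2.1 v.2.2 ha
  -- Letting a → ∞, v^a tends to the indicator of {1} and exp(-a^α) to 0, so 1 is not an atom. This
  -- makes -log v positive.
  have hone : ∀ᵐ v : unitInterval ∂(μ : Measure unitInterval), (v : ℝ) < 1 := by
    have hlim : Tendsto (fun n : ℕ => ∫ v, (v : ℝ) ^ ((n : ℝ) + 1) ∂(μ : Measure unitInterval)) atTop
        (𝓝 (∫ v, ({1} : Set unitInterval).indicator (fun _ => (1 : ℝ)) v
          ∂(μ : Measure unitInterval))) := by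
      refine tendsto_integral_of_dominated_convergence (fun _ => 1)
        (fun n => (hcont _ (by positivity)).aestronglyMeasurable) (integrable_const _)
        (fun n => ae_of_all _ fun v => ?_) (ae_of_all _ fun v => ?_)
      · rw [Real.norm_of_nonneg (Real.rpow_nonneg v.2.1 _)]
        exact Real.rpow_le_one v.2.1 v.2.2 (by positivity)
      · by_cases hv : v = 1
        · simp [hv]
        · have hv1 : (v : ℝ) < 1 := lt_of_le_of_ne v.2.2 fun h => hv (Subtype.ext h)
          rw [indicator_of_notMem (by simpa using hv)]
          have := (tendsto_pow_atTop_nhds_zero_of_lt_one v.2.1 hv1).comp (tendsto_add_atTop_nat 1)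
          refine this.congr fun n => ?_
          simp only [Function.comp]
          rw [← Real.rpow_natCast]
          push_cast
          rfl
    have hlim2 : Tendsto (fun n : ℕ => ∫ v, (v : ℝ) ^ ((n : ℝ) + 1) ∂(μ : Measure unitInterval))
        atTop (𝓝 0) := by
      simp_rw [fun n : ℕ => hμ ((n : ℝ) + 1) (by positivity)]
      refine Real.tendsto_exp_neg_atTop_nhds_zero.comp ((tendsto_rpow_atTop h0).comp ?_)
      exact tendsto_atTop_add_const_right _ _ tendsto_natCast_atTop_atTop
    have h3 := tendsto_nhds_unique hlim hlim2
    rw [integral_indicator (measurableSet_singleton _), setIntegral_const, smul_eq_mul, mul_one,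
      measureReal_eq_zero_iff] at h3
    have h4 : ∀ᵐ v ∂(μ : Measure unitInterval), v ≠ 1 := by
      rw [ae_iff]; simpa using h3
    filter_upwards [h4] with v hv
    exact lt_of_le_of_ne v.2.2 fun h => hv (Subtype.ext h)
  -- Letting a ↓ 0, v^a tends to the indicator of v ≠ 0 and exp(-a^α) to 1, so 0 is not an atom and
  -- -log v is a genuine finite value.
  have hzero : ∀ᵐ v : unitInterval ∂(μ : Measure unitInterval), 0 < (v : ℝ) := by
    have hlim : Tendsto (fun n : ℕ => ∫ v, (v : ℝ) ^ (1 / ((n : ℝ) + 1))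
        ∂(μ : Measure unitInterval)) atTop
        (𝓝 (∫ v, ({0}ᶜ : Set unitInterval).indicator (fun _ => (1 : ℝ)) v
          ∂(μ : Measure unitInterval))) := by
      refine tendsto_integral_of_dominated_convergence (fun _ => 1)
        (fun n => (hcont _ (by positivity)).aestronglyMeasurable) (integrable_const _)
        (fun n => ae_of_all _ fun v => ?_) (ae_of_all _ fun v => ?_)
      · rw [Real.norm_of_nonneg (Real.rpow_nonneg v.2.1 _)]
        exact Real.rpow_le_one v.2.1 v.2.2 (by positivity)
      · by_cases hv : v = 0
        · rw [indicator_of_notMem (by simpa using hv), hv]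
          refine tendsto_const_nhds.congr fun n => ?_
          rw [Set.Icc.coe_zero, Real.zero_rpow (by positivity)]
        · have hv1 : (v : ℝ) ≠ 0 := fun h => hv (Subtype.ext h)
          rw [indicator_of_mem (by simpa using hv)]
          have := ((Real.continuous_const_rpow hv1).tendsto 0).comp
            tendsto_one_div_add_atTop_nhds_zero_nat
          rwa [Real.rpow_zero] at this
    have hlim2 : Tendsto (fun n : ℕ => ∫ v, (v : ℝ) ^ (1 / ((n : ℝ) + 1))
        ∂(μ : Measure unitInterval)) atTop (𝓝 1) := by
      simp_rw [fun n : ℕ => hμ (1 / ((n : ℝ) + 1)) (by positivity)]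
      have hcts : Continuous fun a : ℝ => Real.exp (-a ^ α) :=
        Real.continuous_exp.comp (continuous_id.rpow_const fun _ => Or.inr h0.le).neg
      have := (hcts.tendsto 0).comp tendsto_one_div_add_atTop_nhds_zero_nat
      simpa [Real.zero_rpow h0.ne', Function.comp_def] using this
    have h3 := tendsto_nhds_unique hlim hlim2
    rw [integral_indicator (measurableSet_singleton _).compl, setIntegral_const, smul_eq_mul,
      mul_one] at h3
    have h4 : ∀ᵐ v ∂(μ : Measure unitInterval), v ≠ 0 := by
      have h5 := probReal_compl_eq_one_sub (μ := (μ : Measure unitInterval))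
        (measurableSet_singleton (0 : unitInterval))
      rw [h3] at h5
      rw [ae_iff]
      have h6 : (μ : Measure unitInterval).real {0} = 0 := by linarith
      rw [measureReal_eq_zero_iff] at h6
      simpa using h6
    filter_upwards [h4] with v hv
    exact lt_of_le_of_ne v.2.1 fun h => hv (Subtype.ext h.symm)
  have hlog : Measurable fun v : unitInterval => -Real.log v := by fun_prop
  have hprob : IsProbabilityMeasure ((μ : Measure unitInterval).map fun v : unitInterval => -Real.log v) :=
    Measure.isProbabilityMeasure_map hlog.aemeasurable
  refine ⟨_, hprob, ?_, fun a ha => ?_⟩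
  · rw [ae_map_iff hlog.aemeasurable measurableSet_Ioi]
    filter_upwards [hone, hzero] with v hv1 hv0
    exact neg_pos.2 (Real.log_neg hv0 hv1)
  · rcases ha.eq_or_lt with rfl | ha
    · simp [Real.zero_rpow h0.ne']
    rw [integral_map hlog.aemeasurable (by fun_prop), ← hμ a ha]
    refine integral_congr_ae ?_
    filter_upwards [hzero] with v hv0
    rw [Real.rpow_def_of_pos hv0]
    congr 1
    ring

/-! ### Two-sided estimates for Gaussian mixtures over the stable law. -/

theorem exists_rpow_mul_exp_neg_le (s : ℝ) (hs : 0 ≤ s) :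
    ∃ C : ℝ, 0 < C ∧ ∀ w : ℝ, 0 < w → w ^ s * Real.exp (-w) ≤ C := by
  refine ⟨1 + (⌈s⌉₊.factorial : ℝ), by positivity, fun w hw => ?_⟩
  have he : Real.exp w * Real.exp (-w) = 1 := by rw [← Real.exp_add]; simp
  have hfac : (1 : ℝ) ≤ ⌈s⌉₊.factorial := by exact_mod_cast Nat.factorial_pos _
  have h1 : w ^ s ≤ (1 + (⌈s⌉₊.factorial : ℝ)) * Real.exp w := by
    rcases le_total w 1 with h | h
    · have h2 : w ^ s ≤ 1 := Real.rpow_le_one hw.le h hs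
      have h3 : 1 ≤ Real.exp w := Real.one_le_exp hw.le
      nlinarith
    · have h2 : w ^ s ≤ w ^ ⌈s⌉₊ := by
        rw [← Real.rpow_natCast]
        exact Real.rpow_le_rpow_of_exponent_le h (Nat.le_ceil s)
      have h3 := Real.pow_div_factorial_le_exp w hw.le ⌈s⌉₊
      rw [div_le_iff₀ (by positivity)] at h3
      nlinarith [Real.exp_pos w]
  calc _ ≤ (1 + (⌈s⌉₊.factorial : ℝ)) * Real.exp w * Real.exp (-w) := by gcongr
    _ = _ := by rw [mul_assoc, he, mul_one]

/-- The left side is bounded and O(v) at 0, while 1 - e^{-v} is comparable to min(1,v). Both bounds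
on the left become w^p e^{-w} ≤ C after w = 1/(4v). -/
theorem exists_gaussian_profile_le (s : ℝ) (hs : 0 ≤ s) :
    ∃ C : ℝ, 0 < C ∧ ∀ v : ℝ, 0 < v →
      v ^ (-s) * Real.exp (-(1 / (4 * v))) ≤ C * (1 - Real.exp (-v)) := by
  obtain ⟨A, hA, hA'⟩ := exists_rpow_mul_exp_neg_le s hs
  obtain ⟨B, hB, hB'⟩ := exists_rpow_mul_exp_neg_le (s + 1) (by linarith)
  refine ⟨2 * (4 ^ s * A + 4 ^ (s + 1) * B), by positivity, fun v hv => ?_⟩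
  have hw : 0 < 1 / (4 * v) := by positivity
  have hv4 : v = (4 * (1 / (4 * v)))⁻¹ := by field_simp
  have key : ∀ p : ℝ, v ^ (-p) = 4 ^ p * (1 / (4 * v)) ^ p := fun p => by
    conv_lhs => rw [hv4]
    rw [Real.inv_rpow (by positivity), Real.rpow_neg (by positivity), inv_inv,
      Real.mul_rpow (by norm_num) hw.le]
  have hAs : 0 < (4 : ℝ) ^ s * A := by positivity
  have hBs : 0 < (4 : ℝ) ^ (s + 1) * B := by positivity
  have b1 : v ^ (-s) * Real.exp (-(1 / (4 * v))) ≤ 4 ^ s * A := by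
    rw [key, mul_assoc]
    gcongr
    exact hA' _ hw
  have b2 : v ^ (-s) * Real.exp (-(1 / (4 * v))) ≤ 4 ^ (s + 1) * B * v := by
    have : v ^ (-s) = v ^ (-(s + 1)) * v := by
      rw [← Real.rpow_add_one hv.ne']; congr 1; ring
    rw [this, key]
    have := hB' _ hw
    calc _ = 4 ^ (s + 1) * ((1 / (4 * v)) ^ (s + 1) * Real.exp (-(1 / (4 * v)))) * v := by ring
      _ ≤ _ := by gcongr
  have b3 : v / (1 + v) ≤ 1 - Real.exp (-v) := by
    have h1 := Real.add_one_le_exp v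
    rw [Real.exp_neg]
    have : (Real.exp v)⁻¹ ≤ (1 + v)⁻¹ := by gcongr; linarith
    have e : v / (1 + v) = 1 - (1 + v)⁻¹ := by field_simp; ring
    linarith
  have b4 : min 1 v ≤ 2 * (v / (1 + v)) := by
    rw [← mul_div_assoc, le_div_iff₀ (by positivity)]
    rcases le_total v 1 with h | h
    · rw [min_eq_right h]; nlinarith
    · rw [min_eq_left h]; nlinarith
  calc _ ≤ (4 ^ s * A + 4 ^ (s + 1) * B) * min 1 v := by
        rcases le_total v 1 with h | h
        · rw [min_eq_right h]; nlinarith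
        · rw [min_eq_left h]; nlinarith
    _ ≤ (4 ^ s * A + 4 ^ (s + 1) * B) * (2 * (1 - Real.exp (-v))) := by
        gcongr; linarith
    _ = _ := by ring

theorem sub_sq_div_two_le_one_sub_exp_neg {x : ℝ} (hx : 0 ≤ x) :
    x - x ^ 2 / 2 ≤ 1 - Real.exp (-x) := by
  have h1 := Real.quadratic_le_exp_of_nonneg hx
  have h2 : Real.exp (-x) ≤ 1 - x + x ^ 2 / 2 := by
    rw [Real.exp_neg, inv_le_iff_one_le_mul₀ (Real.exp_pos x)]
    have h3 : 0 ≤ 1 - x + x ^ 2 / 2 := by nlinarith [sq_nonneg (x - 1)]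
    -- (1 + x + x²/2)(1 - x + x²/2) = 1 + x⁴/4 ≥ 1.
    nlinarith [mul_le_mul_of_nonneg_left h1 h3, sq_nonneg (x ^ 2)]
  linarith

/-- Supplies the lower bound for the mixture. In the combination the first and third terms cancel to
first order at 0, leaving -ηv, and the limit at infinity is -1/M. It can thus be positive only for
η/M < v < 2M/η, where the Gaussian profile is bounded below by a positive constant. -/
theorem exists_exp_combination_le_gaussian_profile (s : ℝ) (hs : 0 ≤ s) {η M : ℝ} (hη : 0 < η)
    (hη1 : η ≤ 1) (hM : 1 ≤ M) :
    ∃ B : ℝ, 0 < B ∧ ∀ v : ℝ, 0 < v →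
      (1 - Real.exp (-v)) - (1 - Real.exp (-(η * v))) - M⁻¹ * (1 - Real.exp (-(M * v))) ≤
        B * (v ^ (-s) * Real.exp (-(1 / (4 * v)))) := by
  have hM0 : 0 < M := by linarith
  -- Each factor is taken at its worse endpoint of [η/M, 2M/η].
  set D : ℝ := (2 * M / η) ^ (-s) * Real.exp (-(1 / (4 * (η / M)))) with hD
  have hDpos : 0 < D := by positivity
  refine ⟨D⁻¹, by positivity, fun v hv => ?_⟩
  have hrhs : 0 ≤ D⁻¹ * (v ^ (-s) * Real.exp (-(1 / (4 * v)))) := by positivity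
  rcases le_total v (η / M) with h | h
  · refine le_trans ?_ hrhs
    have h1 := Real.add_one_le_exp (-v)
    have h2 := sub_sq_div_two_le_one_sub_exp_neg (by positivity : 0 ≤ η * v)
    have h3 : M⁻¹ * (M * v - (M * v) ^ 2 / 2) ≤ M⁻¹ * (1 - Real.exp (-(M * v))) :=
      mul_le_mul_of_nonneg_left (sub_sq_div_two_le_one_sub_exp_neg (by positivity)) (by positivity)
    have h4 : M⁻¹ * (M * v - (M * v) ^ 2 / 2) = v - M * v ^ 2 / 2 := by field_simp
    have h5 : v * M ≤ η := (le_div_iff₀ hM0).1 h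
    have h6 : M * v ^ 2 ≤ η * v := by nlinarith
    have h7 : (η * v) ^ 2 ≤ η * v := by
      have : η * v ≤ 1 := by nlinarith
      nlinarith [mul_pos hη hv]
    linarith
  rcases le_total (2 * M / η) v with h' | h'
  · refine le_trans ?_ hrhs
    have h1 : 2 * M ≤ v * η := (div_le_iff₀ hη).1 h'
    have h2 : Real.exp (-(η * v)) ≤ (2 * M)⁻¹ := by
      rw [Real.exp_neg]
      gcongr
      linarith [Real.add_one_le_exp (η * v)]
    have h3 : Real.exp (-(M * v)) ≤ Real.exp (-v) := by
      apply Real.exp_le_exp.2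
      nlinarith
    have h4 : M⁻¹ ≤ 1 := inv_le_one_of_one_le₀ hM
    have h5 : M⁻¹ * Real.exp (-(M * v)) ≤ Real.exp (-v) := by
      nlinarith [Real.exp_pos (-(M * v))]
    have h6 : (2 * M)⁻¹ = M⁻¹ / 2 := by field_simp
    have : 0 < M⁻¹ := by positivity
    linarith
  · have h1 : D ≤ v ^ (-s) * Real.exp (-(1 / (4 * v))) := by
      rw [hD]
      gcongr ?_ * Real.exp (-(1 / (4 * ?_)))
      exact Real.rpow_le_rpow_of_nonpos hv h' (by linarith)
    have h2 : Real.exp (-(η * v)) ≤ 1 := Real.exp_le_one_iff.2 (by nlinarith)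
    have h3 : Real.exp (-(M * v)) ≤ 1 := Real.exp_le_one_iff.2 (by nlinarith)
    have h4 : 0 ≤ M⁻¹ * (1 - Real.exp (-(M * v))) := mul_nonneg (by positivity) (by linarith)
    have h5 : 1 ≤ D⁻¹ * (v ^ (-s) * Real.exp (-(1 / (4 * v)))) := by
      rw [← div_eq_inv_mul, one_le_div hDpos]; exact h1
    linarith [Real.exp_pos (-v)]

/-- With v = u/r² the two profile comparisons are integrated against ν. Since ∫ (1 - e^{-u/r²}) dν =
1 - exp(-r^{-2α}) is of order r^{-2α} for large r, this produces the decay r^{-2s-2α}; bounded r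
follows from monotonicity in r. -/
theorem integral_gaussian_stable_bounds {s α : ℝ} (hs : 0 ≤ s) (h0 : 0 < α) (h1 : α < 1)
    (ν : Measure ℝ) [IsProbabilityMeasure ν] (hpos : ∀ᵐ u ∂ν, 0 < u)
    (hL : ∀ a : ℝ, 0 ≤ a → ∫ u, Real.exp (-(a * u)) ∂ν = Real.exp (-a ^ α))
    (hint : Integrable (fun u : ℝ => u ^ (-s)) ν) :
    ∃ c C : ℝ, 0 < c ∧ 0 < C ∧ ∀ r : ℝ, 0 ≤ r →
      c * (1 + r) ^ (-(2 * s + 2 * α)) ≤ ∫ u, u ^ (-s) * Real.exp (-(r ^ 2 / (4 * u))) ∂ν ∧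
      ∫ u, u ^ (-s) * Real.exp (-(r ^ 2 / (4 * u))) ∂ν ≤ C * (1 + r) ^ (-(2 * s + 2 * α)) := by
  set Q : ℝ → ℝ := fun r => ∫ u, u ^ (-s) * Real.exp (-(r ^ 2 / (4 * u))) ∂ν with hQ
  have hQint : ∀ r : ℝ, Integrable (fun u => u ^ (-s) * Real.exp (-(r ^ 2 / (4 * u)))) ν := by
    intro r
    refine hint.mono' (by fun_prop) ?_
    filter_upwards [hpos] with u hu
    rw [Real.norm_of_nonneg (by positivity)]
    exact mul_le_of_le_one_right (by positivity)
      (Real.exp_le_one_iff.2 (neg_nonpos.2 (by positivity)))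
  have hanti : ∀ r₁ r₂ : ℝ, 0 ≤ r₁ → r₁ ≤ r₂ → Q r₂ ≤ Q r₁ := by
    intro r₁ r₂ hr₁ hr
    refine integral_mono_ae (hQint r₂) (hQint r₁) ?_
    filter_upwards [hpos] with u hu
    gcongr
  have hLint : ∀ a : ℝ, 0 ≤ a → Integrable (fun u => Real.exp (-(a * u))) ν := by
    intro a ha
    refine Integrable.of_bound (by fun_prop) 1 ?_
    filter_upwards [hpos] with u hu
    rw [Real.norm_of_nonneg (Real.exp_pos _).le]
    exact Real.exp_le_one_iff.2 (neg_nonpos.2 (by positivity))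
  have hLint1 : ∀ a : ℝ, 0 ≤ a → Integrable (fun u => 1 - Real.exp (-(a * u))) ν :=
    fun a ha => (integrable_const 1).sub (hLint a ha)
  have hL1 : ∀ a : ℝ, 0 ≤ a → ∫ u, (1 - Real.exp (-(a * u))) ∂ν = 1 - Real.exp (-a ^ α) := by
    intro a ha
    rw [integral_sub (integrable_const 1) (hLint a ha), hL a ha]
    simp
  -- the integrand in the self-similar variable
  have hscale : ∀ r u : ℝ, 0 < r → 0 < u → u ^ (-s) * Real.exp (-(r ^ 2 / (4 * u))) =
      r ^ (-(2 * s)) * (((r ^ 2)⁻¹ * u) ^ (-s) *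
        Real.exp (-(1 / (4 * ((r ^ 2)⁻¹ * u))))) := by
    intro r u hr hu
    have e1 : r ^ (-(2 * s)) = (r ^ 2) ^ (-s) := by
      rw [← Real.rpow_natCast r 2, ← Real.rpow_mul hr.le]; congr 1; push_cast; ring
    have e2 : u ^ (-s) = (r ^ 2) ^ (-s) * ((r ^ 2)⁻¹ * u) ^ (-s) := by
      rw [← Real.mul_rpow (by positivity) (by positivity), mul_inv_cancel_left₀ (by positivity)]
    have e3 : r ^ 2 / (4 * u) = 1 / (4 * ((r ^ 2)⁻¹ * u)) := by field_simp
    rw [e1, e2, e3]; ring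
  have hpow : ∀ r : ℝ, 0 < r → ((r ^ 2)⁻¹) ^ α = r ^ (-(2 * α)) := by
    intro r hr
    rw [← Real.rpow_natCast r 2, ← Real.rpow_neg hr.le, ← Real.rpow_mul hr.le]
    congr 1; push_cast; ring
  have hmul : ∀ r : ℝ, 0 < r → r ^ (-(2 * s)) * r ^ (-(2 * α)) = r ^ (-(2 * s + 2 * α)) := by
    intro r hr
    rw [← Real.rpow_add hr]; congr 1; ring
  have hexpo : -(2 * s + 2 * α) ≤ 0 := by linarith
  obtain ⟨A, hA, hA'⟩ := exists_gaussian_profile_le s hs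
  have hup : ∀ r : ℝ, 0 < r → Q r ≤ A * r ^ (-(2 * s + 2 * α)) := by
    intro r hr
    have hr2 : 0 ≤ (r ^ 2)⁻¹ := by positivity
    calc Q r ≤ ∫ u, r ^ (-(2 * s)) * A * (1 - Real.exp (-((r ^ 2)⁻¹ * u))) ∂ν := by
          refine integral_mono_ae (hQint r) ((hLint1 _ hr2).const_mul _) ?_
          filter_upwards [hpos] with u hu
          rw [hscale r u hr hu, mul_assoc]
          exact mul_le_mul_of_nonneg_left (hA' _ (mul_pos (inv_pos.2 (pow_pos hr 2)) hu))
            (by positivity)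
      _ = r ^ (-(2 * s)) * A * (1 - Real.exp (-r ^ (-(2 * α)))) := by
          rw [integral_const_mul, hL1 _ hr2, hpow r hr]
      _ ≤ r ^ (-(2 * s)) * A * r ^ (-(2 * α)) := by
          gcongr
          linarith [Real.add_one_le_exp (-r ^ (-(2 * α)))]
      _ = _ := by rw [← hmul r hr]; ring
  -- Chosen so that η^α = M^{α-1} = 1/4. With σ = r^{-2α}, the integrated combination is then at
  -- least σ(1 - 1/4 - 1/4) - σ²/2, hence at least σ/4 once σ ≤ 1/2: the first-order cancellation at
  -- v = 0 does not persist after integration, because α < 1.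
  set η : ℝ := (1 / 4) ^ (1 / α) with hη
  set M : ℝ := 4 ^ (1 / (1 - α)) with hM
  have hηpos : 0 < η := by positivity
  have hη1 : η ≤ 1 := Real.rpow_le_one (by norm_num) (by norm_num) (by positivity)
  have hM1 : 1 ≤ M := Real.one_le_rpow (by norm_num) (div_nonneg one_pos.le (by linarith))
  have hMpos : 0 < M := by linarith
  have hηα : η ^ α = 1 / 4 := by
    rw [hη, ← Real.rpow_mul (by norm_num), one_div_mul_cancel h0.ne', Real.rpow_one]
  have hMα : M⁻¹ * M ^ α = 1 / 4 := by
    rw [← Real.rpow_neg_one M, ← Real.rpow_add hMpos, hM, ← Real.rpow_mul (by norm_num)]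
    rw [show 1 / (1 - α) * (-1 + α) = -1 by
      have : 1 - α ≠ 0 := by linarith
      field_simp; ring]
    norm_num [Real.rpow_neg_one]
  obtain ⟨B, hB, hB'⟩ := exists_exp_combination_le_gaussian_profile s hs hηpos hη1 hM1
  have hlow : ∀ r : ℝ, 0 < r → r ^ (-(2 * α)) ≤ 1 / 2 →
      (4 * B)⁻¹ * r ^ (-(2 * s + 2 * α)) ≤ Q r := by
    intro r hr hr'
    have hr2 : 0 ≤ (r ^ 2)⁻¹ := by positivity
    set q := (r ^ 2)⁻¹ with hq
    set σ := r ^ (-(2 * α)) with hσ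
    have hσpos : 0 < σ := by positivity
    have i₁ := hLint1 q hr2
    have i₂ := hLint1 (η * q) (by positivity)
    have i₃ := (hLint1 (M * q) (by positivity)).const_mul M⁻¹
    have i₁₂ : Integrable (fun u => (1 - Real.exp (-(q * u))) - (1 - Real.exp (-(η * q * u)))) ν :=
      i₁.sub i₂
    have hk : ∫ u, ((1 - Real.exp (-(q * u))) - (1 - Real.exp (-(η * q * u))) -
        M⁻¹ * (1 - Real.exp (-(M * q * u)))) ∂ν =
        (1 - Real.exp (-σ)) - (1 - Real.exp (-(1 / 4 * σ))) -
          M⁻¹ * (1 - Real.exp (-(M ^ α * σ))) := by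
      rw [integral_sub i₁₂ i₃, integral_sub i₁ i₂, integral_const_mul, hL1 _ hr2, hL1 _ (by positivity),
        hL1 _ (by positivity), Real.mul_rpow hηpos.le hr2, Real.mul_rpow hMpos.le hr2, hηα,
        hpow r hr]
    have hk2 : σ / 4 ≤ (1 - Real.exp (-σ)) - (1 - Real.exp (-(1 / 4 * σ))) -
          M⁻¹ * (1 - Real.exp (-(M ^ α * σ))) := by
      have t1 := sub_sq_div_two_le_one_sub_exp_neg hσpos.le
      have t2 := Real.add_one_le_exp (-(1 / 4 * σ))
      have t3 : M⁻¹ * (1 - Real.exp (-(M ^ α * σ))) ≤ M⁻¹ * (M ^ α * σ) := by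
        gcongr
        linarith [Real.add_one_le_exp (-(M ^ α * σ))]
      rw [← mul_assoc, hMα] at t3
      nlinarith
    have hle : σ / 4 ≤ B * r ^ (2 * s) * Q r := by
      refine hk2.trans ?_
      rw [← hk, hQ]
      simp only
      rw [← integral_const_mul]
      refine integral_mono_ae (i₁₂.sub i₃) ((hQint r).const_mul _) ?_
      filter_upwards [hpos] with u hu
      have hqu : 0 < q * u := mul_pos (inv_pos.2 (pow_pos hr 2)) hu
      have := hB' (q * u) hqu
      rw [hscale r u hr hu, Real.rpow_neg hr.le (2 * s), mul_assoc B,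
        mul_inv_cancel_left₀ (by positivity)]
      simpa only [mul_assoc] using this
    have hc : r ^ (-(2 * s)) * r ^ (2 * s) = 1 := by
      rw [← Real.rpow_add hr]; simp
    calc (4 * B)⁻¹ * r ^ (-(2 * s + 2 * α)) = B⁻¹ * r ^ (-(2 * s)) * (σ / 4) := by
          rw [← hmul r hr, mul_inv]; ring
      _ ≤ B⁻¹ * r ^ (-(2 * s)) * (B * r ^ (2 * s) * Q r) := by gcongr
      _ = B⁻¹ * B * (r ^ (-(2 * s)) * r ^ (2 * s)) * Q r := by ring
      _ = Q r := by rw [hc, inv_mul_cancel₀ hB.ne']; ring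
  -- The radius at which σ = 1/2; below it Q r ≥ Q R.
  set R : ℝ := 2 ^ (1 / (2 * α)) with hR
  have hRpos : 0 < R := by positivity
  have hRσ : R ^ (-(2 * α)) = 1 / 2 := by
    rw [hR, ← Real.rpow_mul (by norm_num),
      show 1 / (2 * α) * -(2 * α) = -1 by field_simp, Real.rpow_neg_one]
    norm_num
  have hlowc : 0 < (4 * B)⁻¹ * R ^ (-(2 * s + 2 * α)) := by positivity
  have hone : ∀ r : ℝ, 0 ≤ r → (1 + r) ^ (-(2 * s + 2 * α)) ≤ 1 := fun r hr =>
    Real.rpow_le_one_of_one_le_of_nonpos (by linarith) hexpo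
  refine ⟨min ((4 * B)⁻¹) ((4 * B)⁻¹ * R ^ (-(2 * s + 2 * α))),
    max A (Q 0 + 1) * 2 ^ (2 * s + 2 * α), lt_min (by positivity) hlowc,
    mul_pos (lt_max_of_lt_left hA) (by positivity), fun r hr => ⟨?_, ?_⟩⟩
  · change _ ≤ Q r
    have hpp : 0 ≤ (1 + r) ^ (-(2 * s + 2 * α)) := by positivity
    rcases le_total r R with h | h
    · calc _ ≤ (4 * B)⁻¹ * R ^ (-(2 * s + 2 * α)) * 1 :=
            mul_le_mul (min_le_right _ _) (hone r hr) hpp hlowc.le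
        _ ≤ Q R := by rw [mul_one]; exact hlow R hRpos hRσ.le
        _ ≤ Q r := hanti r R hr h
    · have hr0 : 0 < r := hRpos.trans_le h
      calc _ ≤ (4 * B)⁻¹ * r ^ (-(2 * s + 2 * α)) := by
            refine mul_le_mul (min_le_left _ _) ?_ hpp (by positivity)
            exact Real.rpow_le_rpow_of_nonpos hr0 (by linarith) hexpo
        _ ≤ Q r := hlow r hr0 (by
            rw [← hRσ]; exact Real.rpow_le_rpow_of_nonpos hRpos h (by linarith))
  · change Q r ≤ _
    -- Used with x = 1 for r ≤ 1 and x = r for r ≥ 1, since 1 + r ≤ 2 max(1, r).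
    have h2 : ∀ x : ℝ, 0 < x → 1 + r ≤ 2 * x → x ^ (-(2 * s + 2 * α)) ≤
        2 ^ (2 * s + 2 * α) * (1 + r) ^ (-(2 * s + 2 * α)) := by
      intro x hx hxr
      have e : x ^ (-(2 * s + 2 * α)) = 2 ^ (2 * s + 2 * α) * (2 * x) ^ (-(2 * s + 2 * α)) := by
        rw [Real.mul_rpow (by norm_num) hx.le, ← mul_assoc, ← Real.rpow_add (by norm_num)]
        simp
      rw [e]
      gcongr ?_ * ?_
      exact Real.rpow_le_rpow_of_nonpos (by linarith) hxr hexpo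
    rcases le_total r 1 with h | h
    · have h3 := h2 1 one_pos (by linarith)
      rw [Real.one_rpow] at h3
      have hmax : Q 0 ≤ max A (Q 0 + 1) := (le_add_of_nonneg_right zero_le_one).trans (le_max_right _ _)
      calc Q r ≤ Q 0 := hanti 0 r le_rfl hr
        _ ≤ max A (Q 0 + 1) * 1 := by rw [mul_one]; exact hmax
        _ ≤ max A (Q 0 + 1) * (2 ^ (2 * s + 2 * α) * (1 + r) ^ (-(2 * s + 2 * α))) :=
            mul_le_mul_of_nonneg_left h3 (hA.le.trans (le_max_left _ _))
        _ = _ := by ring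
    · have hr0 : 0 < r := by linarith
      calc Q r ≤ A * r ^ (-(2 * s + 2 * α)) := hup r hr0
        _ ≤ max A (Q 0 + 1) * (2 ^ (2 * s + 2 * α) * (1 + r) ^ (-(2 * s + 2 * α))) :=
            mul_le_mul (le_max_left _ _) (h2 r hr0 (by linarith)) (by positivity)
              (hA.le.trans (le_max_left _ _))
        _ = _ := by ring

/-! ### The Fourier integral: scaling, subordination and bounds at time one. -/

theorem integrable_exp_neg_norm_rpow {N : ℕ} (hN : 1 ≤ N) {θ : ℝ} (hθ : 0 < θ) :
    Integrable fun ξ : EuclideanSpace ℝ (Fin N) => Real.exp (-‖ξ‖ ^ θ) := by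
  have : Nonempty (Fin N) := ⟨⟨0, hN⟩⟩
  rw [integrable_fun_norm_addHaar volume (f := fun r => Real.exp (-r ^ θ))]
  have h := integrableOn_rpow_mul_exp_neg_rpow (s := ((N - 1 : ℕ) : ℝ)) (p := θ)
    (by linarith [(Nat.cast_nonneg (N - 1) : (0 : ℝ) ≤ _)]) hθ
  refine h.congr_fun (fun y _ => ?_) measurableSet_Ioi
  simp [Real.rpow_natCast]

theorem measurable_fracHeatKernel {N : ℕ} (θ t : ℝ) :
    Measurable fun x : EuclideanSpace ℝ (Fin N) => fracHeatKernel θ x t := by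
  have : StronglyMeasurable fun x : EuclideanSpace ℝ (Fin N) =>
      ∫ ξ : EuclideanSpace ℝ (Fin N),
        Complex.exp (Complex.I * (inner ℝ x ξ : ℝ)) * (Real.exp (-t * ‖ξ‖ ^ θ) : ℝ) := by
    apply StronglyMeasurable.integral_prod_right
    apply Measurable.stronglyMeasurable
    unfold Function.uncurry
    fun_prop
  exact Complex.measurable_re.comp (this.measurable.const_mul _)

/-- Self-similarity of the fractional heat kernel. -/
theorem fracHeatKernel_scaling {N : ℕ} (θ : ℝ) (x : EuclideanSpace ℝ (Fin N))
    {ρ : ℝ} (hρ : 0 < ρ) :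
    fracHeatKernel θ x (ρ ^ θ) = (ρ ^ N)⁻¹ * fracHeatKernel θ (ρ⁻¹ • x) 1 := by
  have h := Measure.integral_comp_smul (volume : Measure (EuclideanSpace ℝ (Fin N)))
    (fun ξ => Complex.exp (Complex.I * (inner ℝ (ρ⁻¹ • x) ξ : ℝ)) *
      (Real.exp (-1 * ‖ξ‖ ^ θ) : ℝ)) ρ
  have e : ∀ ξ : EuclideanSpace ℝ (Fin N),
      Complex.exp (Complex.I * (inner ℝ (ρ⁻¹ • x) (ρ • ξ) : ℝ)) *
        (Real.exp (-1 * ‖ρ • ξ‖ ^ θ) : ℝ) =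
      Complex.exp (Complex.I * (inner ℝ x ξ : ℝ)) * (Real.exp (-ρ ^ θ * ‖ξ‖ ^ θ) : ℝ) := by
    intro ξ
    rw [real_inner_smul_left, real_inner_smul_right, inv_mul_cancel_left₀ hρ.ne', norm_smul,
      Real.norm_of_nonneg hρ.le, Real.mul_rpow hρ.le (norm_nonneg _)]
    congr 3
    ring
  simp_rw [e] at h
  rw [finrank_euclideanSpace_fin, abs_of_pos (by positivity)] at h
  rw [fracHeatKernel, fracHeatKernel, fracHeatKernelC, fracHeatKernelC, h, mul_smul_comm,
    Complex.real_smul, Complex.re_ofReal_mul]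

/-- The fractional heat kernel as a mixture of Gaussians. -/
theorem fracHeatKernel_one_eq_integral_gaussian {N : ℕ} (hN : 1 ≤ N) {θ : ℝ} (hθ : 0 < θ)
    (ν : Measure ℝ) [IsProbabilityMeasure ν] (hpos : ∀ᵐ u ∂ν, 0 < u)
    (hL : ∀ a : ℝ, 0 ≤ a → ∫ u, Real.exp (-(a * u)) ∂ν = Real.exp (-a ^ (θ / 2)))
    (x : EuclideanSpace ℝ (Fin N)) :
    Integrable (fun u : ℝ => u ^ (-(N / 2 : ℝ)) * Real.exp (-(‖x‖ ^ 2 / (4 * u)))) ν ∧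
    fracHeatKernel θ x 1 = ((2 * Real.pi) ^ N)⁻¹ * Real.pi ^ (N / 2 : ℝ) *
      ∫ u, u ^ (-(N / 2 : ℝ)) * Real.exp (-(‖x‖ ^ 2 / (4 * u))) ∂ν := by
  set F : ℝ → EuclideanSpace ℝ (Fin N) → ℂ := fun u ξ =>
    Complex.exp (Complex.I * (inner ℝ x ξ : ℝ)) * (Real.exp (-(‖ξ‖ ^ 2 * u)) : ℝ) with hF
  have hFnorm : ∀ u ξ, ‖F u ξ‖ = Real.exp (-(‖ξ‖ ^ 2 * u)) := fun u ξ => by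
    rw [hF]
    simp only
    rw [norm_mul, mul_comm Complex.I, Complex.norm_exp_ofReal_mul_I, one_mul, Complex.norm_real,
      Real.norm_of_nonneg (Real.exp_pos _).le]
  have hLξ : ∀ ξ : EuclideanSpace ℝ (Fin N),
      ∫ u, Real.exp (-(‖ξ‖ ^ 2 * u)) ∂ν = Real.exp (-‖ξ‖ ^ θ) := fun ξ => by
    rw [hL _ (by positivity), ← Real.rpow_natCast, ← Real.rpow_mul (norm_nonneg _)]
    congr 3
    push_cast
    ring
  have hFm : AEStronglyMeasurable (Function.uncurry F) (ν.prod volume) := by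
    apply Measurable.aestronglyMeasurable
    unfold Function.uncurry
    fun_prop
  -- Integrating |F| in u first leaves e^{-|ξ|^θ}, which is integrable in ξ.
  have hFint : Integrable (Function.uncurry F) (ν.prod volume) := by
    rw [integrable_prod_iff' hFm]
    refine ⟨ae_of_all _ fun ξ => ?_, ?_⟩
    · refine Integrable.of_bound (by simp only [Function.uncurry, hF]; fun_prop) 1 ?_
      filter_upwards [hpos] with u hu
      simp only [Function.uncurry]
      rw [hFnorm]
      exact Real.exp_le_one_iff.2 (neg_nonpos.2 (by positivity))
    · simp only [Function.uncurry, hFnorm, hLξ]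
      exact integrable_exp_neg_norm_rpow hN hθ
  have hswap := integral_integral_swap hFint
  have hgauss : ∀ u : ℝ, 0 < u → ∫ ξ, F u ξ =
      ((Real.pi ^ (N / 2 : ℝ) * (u ^ (-(N / 2 : ℝ)) * Real.exp (-(‖x‖ ^ 2 / (4 * u)))) : ℝ) : ℂ) := by
    intro u hu
    have h := GaussianFourier.integral_cexp_neg_mul_sq_norm_add (b := (u : ℂ)) (by simpa using hu)
      Complex.I x
    have e : ∀ ξ : EuclideanSpace ℝ (Fin N), F u ξ =
        Complex.exp (-(u : ℂ) * (‖ξ‖ : ℂ) ^ 2 + Complex.I * (inner ℝ x ξ : ℝ)) := fun ξ => by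
      simp only [hF]
      rw [Complex.ofReal_exp, ← Complex.exp_add]
      congr 1
      push_cast
      ring
    simp_rw [e]
    rw [h, finrank_euclideanSpace_fin]
    have e1 : ((Real.pi : ℂ) / u) ^ ((N : ℂ) / 2) =
        ((Real.pi ^ (N / 2 : ℝ) * u ^ (-(N / 2 : ℝ)) : ℝ) : ℂ) := by
      rw [Real.rpow_neg hu.le, ← div_eq_mul_inv, ← Real.div_rpow Real.pi_pos.le hu.le,
        Complex.ofReal_cpow (by positivity)]
      push_cast
      rfl
    have e2 : Complex.I ^ 2 * (‖x‖ : ℂ) ^ 2 / (4 * u) = ((-(‖x‖ ^ 2 / (4 * u)) : ℝ) : ℂ) := by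
      rw [Complex.I_sq]
      push_cast
      ring
    rw [e1, e2, ← Complex.ofReal_exp, ← Complex.ofReal_mul, mul_assoc]
  have hpi : (0 : ℝ) < Real.pi ^ (N / 2 : ℝ) := Real.rpow_pos_of_pos Real.pi_pos _
  constructor
  · have h1 : Integrable (fun u : ℝ => ∫ ξ, F u ξ) ν := hFint.integral_prod_left
    have h2 := (h1.re.const_mul (Real.pi ^ (N / 2 : ℝ))⁻¹)
    refine h2.congr ?_
    filter_upwards [hpos] with u hu
    rw [hgauss u hu]
    rw [RCLike.re_eq_complex_re, Complex.ofReal_re, inv_mul_cancel_left₀ hpi.ne']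
  · have hleft : ∫ u, (∫ ξ, F u ξ) ∂ν = ((Real.pi ^ (N / 2 : ℝ) *
        ∫ u, u ^ (-(N / 2 : ℝ)) * Real.exp (-(‖x‖ ^ 2 / (4 * u))) ∂ν : ℝ) : ℂ) := by
      rw [← integral_const_mul, ← integral_complex_ofReal]
      refine integral_congr_ae ?_
      filter_upwards [hpos] with u hu using hgauss u hu
    have hright : ∀ ξ : EuclideanSpace ℝ (Fin N), ∫ u, F u ξ ∂ν =
        Complex.exp (Complex.I * (inner ℝ x ξ : ℝ)) * (Real.exp (-1 * ‖ξ‖ ^ θ) : ℝ) := fun ξ => by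
      simp only [hF]
      rw [integral_const_mul, integral_complex_ofReal, hLξ, neg_one_mul]
    simp_rw [hright] at hswap
    rw [fracHeatKernel, fracHeatKernelC, ← hswap, hleft, Complex.re_ofReal_mul, Complex.ofReal_re,
      mul_assoc]

/-- Two-sided bounds for the fractional heat kernel at time one. -/
theorem fracHeatKernel_one_bounds {N : ℕ} (hN : 1 ≤ N) {θ : ℝ} (hθ0 : 0 < θ) (hθ2 : θ < 2) :
    ∃ c C : ℝ, 0 < c ∧ 0 < C ∧ ∀ x : EuclideanSpace ℝ (Fin N),
      c * (1 + ‖x‖) ^ (-(N + θ)) ≤ fracHeatKernel θ x 1 ∧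
      fracHeatKernel θ x 1 ≤ C * (1 + ‖x‖) ^ (-(N + θ)) := by
  obtain ⟨ν, hν, hpos, hL⟩ := exists_stable_subordinator (α := θ / 2) (by linarith) (by linarith)
  have hrep := fracHeatKernel_one_eq_integral_gaussian hN hθ0 ν hpos hL
  -- At x = 0 the Gaussian factor is 1, so Fubini also yields the finite negative moment of ν.
  have hint : Integrable (fun u : ℝ => u ^ (-(N / 2 : ℝ))) ν := by
    simpa using (hrep 0).1
  obtain ⟨c, C, hc, hC, h⟩ := integral_gaussian_stable_bounds (s := N / 2) (by positivity)
    (by linarith) (by linarith) ν hpos hL hint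
  have hk : 0 < ((2 * Real.pi) ^ N)⁻¹ * Real.pi ^ (N / 2 : ℝ) := by positivity
  refine ⟨_, _, mul_pos hk hc, mul_pos hk hC, fun x => ?_⟩
  have hx := h ‖x‖ (norm_nonneg x)
  rw [show (2 * (N / 2 : ℝ) + 2 * (θ / 2)) = N + θ by ring] at hx
  rw [(hrep x).2, mul_assoc _ c, mul_assoc _ C]
  exact ⟨mul_le_mul_of_nonneg_left hx.1 hk.le, mul_le_mul_of_nonneg_left hx.2 hk.le⟩

/-! ### The comparison profile and its products. -/

/-- The profile `ρ^θ (ρ + r)^{-N-θ}` comparable to `P_θ(x, ρ^θ)` at `|x| = r`. -/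
noncomputable def stableProfile (N : ℕ) (θ ρ r : ℝ) : ℝ := ρ ^ θ * (ρ + r) ^ (-(N + θ))

theorem stableProfile_pos (N : ℕ) (θ : ℝ) {ρ r : ℝ} (hρ : 0 < ρ) (hr : 0 ≤ r) :
    0 < stableProfile N θ ρ r := by
  unfold stableProfile
  positivity

theorem stableProfile_eq_scaling {N : ℕ} (θ : ℝ) (x : EuclideanSpace ℝ (Fin N)) {ρ : ℝ}
    (hρ : 0 < ρ) :
    stableProfile N θ ρ ‖x‖ = (ρ ^ N)⁻¹ * (1 + ‖ρ⁻¹ • x‖) ^ (-(N + θ)) := by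
  have e : ρ + ‖x‖ = ρ * (1 + ‖ρ⁻¹ • x‖) := by
    rw [norm_smul, norm_inv, Real.norm_of_nonneg hρ.le, mul_add, mul_inv_cancel_left₀ hρ.ne',
      mul_one]
  rw [stableProfile, e, Real.mul_rpow hρ.le (by positivity), ← mul_assoc, ← Real.rpow_add hρ,
    show θ + -(N + θ) = -(N : ℝ) by ring, Real.rpow_neg hρ.le, Real.rpow_natCast]

theorem integrable_stableProfile {N : ℕ} {θ ρ : ℝ} (hθ : 0 < θ) (hρ : 0 < ρ) :
    Integrable fun x : EuclideanSpace ℝ (Fin N) => stableProfile N θ ρ ‖x‖ := by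
  simp_rw [fun x : EuclideanSpace ℝ (Fin N) => stableProfile_eq_scaling θ x hρ]
  refine Integrable.const_mul ?_ _
  rw [integrable_comp_smul_iff volume
    (fun x : EuclideanSpace ℝ (Fin N) => (1 + ‖x‖) ^ (-(N + θ))) (inv_ne_zero hρ.ne')]
  exact integrable_one_add_norm (by simpa using hθ)

theorem integral_stableProfile {N : ℕ} (θ : ℝ) {ρ : ℝ} (hρ : 0 < ρ) :
    ∫ x : EuclideanSpace ℝ (Fin N), stableProfile N θ ρ ‖x‖ =
      ∫ x : EuclideanSpace ℝ (Fin N), (1 + ‖x‖) ^ (-(N + θ)) := by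
  simp_rw [fun x : EuclideanSpace ℝ (Fin N) => stableProfile_eq_scaling θ x hρ]
  rw [integral_const_mul, Measure.integral_comp_inv_smul volume
    (fun x : EuclideanSpace ℝ (Fin N) => (1 + ‖x‖) ^ (-(N + θ))), finrank_euclideanSpace_fin,
    abs_of_pos (by positivity), smul_eq_mul, inv_mul_cancel_left₀ (by positivity)]

theorem stableProfile_le_of_add_le {N : ℕ} {θ a r A p q : ℝ} (hθ : 0 < θ) (ha : 0 < a)
    (har : a ≤ r) (hA : 0 < A) (hp : 0 ≤ p) (hq : 0 ≤ q) (h : r + p ≤ A * (a + q)) :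
    stableProfile N θ a q ≤ A ^ (N + θ) * stableProfile N θ r p := by
  have hr : 0 < r := ha.trans_le har
  unfold stableProfile
  have h1 : (A * (a + q)) ^ (-(N + θ)) ≤ (r + p) ^ (-(N + θ)) :=
    Real.rpow_le_rpow_of_nonpos (by positivity) h (by linarith [(Nat.cast_nonneg N : (0 : ℝ) ≤ N)])
  rw [Real.mul_rpow hA.le (by positivity), Real.rpow_neg hA.le,
    inv_mul_le_iff₀ (by positivity)] at h1
  calc _ ≤ r ^ θ * (A ^ (N + θ) * (r + p) ^ (-(N + θ))) := by gcongr
    _ = _ := by ring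

/-- The product of two translated profiles is at most a multiple of the profile at the larger scale
times their sum. -/
theorem stableProfile_mul_le {N : ℕ} {θ a b r κ : ℝ} (hθ : 0 < θ) (ha : 0 < a) (hb : 0 < b)
    (har : a ≤ r) (hbr : b ≤ r) (hκ : 0 < κ) (hr : r ≤ κ * a ∨ r ≤ κ * b)
    (x y : EuclideanSpace ℝ (Fin N)) :
    stableProfile N θ a ‖x - y‖ * stableProfile N θ b ‖y‖ ≤
      (4 + 2 * κ) ^ (N + θ) * stableProfile N θ r ‖x‖ *
        (stableProfile N θ a ‖x - y‖ + stableProfile N θ b ‖y‖) := by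
  have hqa := stableProfile_pos N θ ha (norm_nonneg (x - y))
  have hqb := stableProfile_pos N θ hb (norm_nonneg y)
  have hxy := norm_nonneg (x - y)
  have hy := norm_nonneg y
  have hx := norm_nonneg x
  have htri : ‖x‖ ≤ ‖x - y‖ + ‖y‖ := by simpa using norm_add_le (x - y) y
  have hr0 : 0 < r := ha.trans_le har
  have hE : 0 < (4 + 2 * κ) ^ (N + θ) * stableProfile N θ r ‖x‖ :=
    mul_pos (by positivity) (stableProfile_pos N θ hr0 hx)
  -- If |x| ≤ r, then r + |x| ≤ 2r ≤ 2κ max(a, b); otherwise r + |x| ≤ 2|x| ≤ 4 max(|x-y|, |y|). The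
  -- constant 4 + 2κ covers both.
  have hor : r + ‖x‖ ≤ (4 + 2 * κ) * (a + ‖x - y‖) ∨ r + ‖x‖ ≤ (4 + 2 * κ) * (b + ‖y‖) := by
    have p1 := mul_nonneg hκ.le hxy
    have p2 := mul_nonneg hκ.le hy
    have p3 := mul_pos hκ ha
    have p4 := mul_pos hκ hb
    rcases le_total ‖x‖ r with h | h
    · rcases hr with h' | h'
      · left; nlinarith
      · right; nlinarith
    · rcases le_total ‖y‖ ‖x - y‖ with h' | h'
      · left; nlinarith
      · right; nlinarith
  rcases hor with h | h
  · have := stableProfile_le_of_add_le (N := N) hθ ha har (by positivity) hx hxy h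
    nlinarith [mul_le_mul_of_nonneg_right this hqb.le, mul_pos hE hqa]
  · have := stableProfile_le_of_add_le (N := N) hθ hb hbr (by positivity) hx hy h
    nlinarith [mul_le_mul_of_nonneg_left this hqa.le, mul_pos hE hqb]

/-! ### Kernel estimates and the theorem. -/

theorem majorantKernel_bounds {N : ℕ} (hN : 1 ≤ N) (d : ℝ) {θ : ℝ} (hθ0 : 0 < θ)
    (hθ2 : θ < 2) :
    ∃ c C : ℝ, 0 < c ∧ 0 < C ∧ ∀ (x : EuclideanSpace ℝ (Fin N)) (t : ℝ), 0 < t →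
      c * stableProfile N θ (t ^ (1 / d)) ‖x‖ ≤ majorantKernel d θ x t ∧
      majorantKernel d θ x t ≤ C * stableProfile N θ (t ^ (1 / d)) ‖x‖ := by
  obtain ⟨c, C, hc, hC, h⟩ := fracHeatKernel_one_bounds hN hθ0 hθ2
  refine ⟨c, C, hc, hC, fun x t ht => ?_⟩
  have hρ : 0 < t ^ (1 / d) := by positivity
  have e : t ^ (θ / d) = (t ^ (1 / d)) ^ θ := by
    rw [← Real.rpow_mul ht.le]; congr 1; ring
  have hx := h ((t ^ (1 / d))⁻¹ • x)
  have hi : 0 ≤ ((t ^ (1 / d)) ^ N)⁻¹ := by positivity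
  rw [majorantKernel, e, fracHeatKernel_scaling θ x hρ, stableProfile_eq_scaling θ x hρ]
  constructor
  · rw [mul_left_comm]
    exact mul_le_mul_of_nonneg_left hx.1 hi
  · rw [mul_left_comm]
    exact mul_le_mul_of_nonneg_left hx.2 hi

theorem exists_majorantKernel_convolution_le {N : ℕ} (hN : 1 ≤ N) {d θ : ℝ} (hd : 0 < d)
    (hθ0 : 0 < θ) (hθ2 : θ < 2) :
    ∃ C : ℝ, 0 < C ∧ ∀ (x : EuclideanSpace ℝ (Fin N)) (s t : ℝ), 0 < s → s < t →
      Integrable (fun y => majorantKernel d θ (x - y) (t - s) * majorantKernel d θ y s) ∧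
      ∫ y, majorantKernel d θ (x - y) (t - s) * majorantKernel d θ y s
        ≤ C * majorantKernel d θ x t := by
  obtain ⟨c, C, hc, hC, hK⟩ := majorantKernel_bounds hN d hθ0 hθ2
  set J : ℝ := ∫ x : EuclideanSpace ℝ (Fin N), (1 + ‖x‖) ^ (-(N + θ)) with hJ
  have hJ0 : 0 ≤ J := integral_nonneg fun x => by positivity
  set A : ℝ := (4 + 2 * 2 ^ (1 / d)) ^ (N + θ) with hA
  have hA0 : 0 < A := by positivity
  -- C² bounds the two kernels by profiles, A is the pointwise product constant, 2J the mass of the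
  -- two profiles (+1 for positivity), and 1/c returns from the profile to the kernel.
  refine ⟨C ^ 2 * A * (2 * J + 1) / c, by positivity, fun x s t hs hst => ?_⟩
  have ht : 0 < t := hs.trans hst
  have hts : 0 < t - s := sub_pos.2 hst
  have hd' : 0 ≤ 1 / d := by positivity
  set a := (t - s) ^ (1 / d) with ha
  set b := s ^ (1 / d) with hb
  set r := t ^ (1 / d) with hr
  have ha0 : 0 < a := by positivity
  have hb0 : 0 < b := by positivity
  have hr0 : 0 < r := by positivity
  have har : a ≤ r := Real.rpow_le_rpow hts.le (by linarith) hd'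
  have hbr : b ≤ r := Real.rpow_le_rpow hs.le hst.le hd'
  -- The larger of s and t - s is at least t/2.
  have hor : r ≤ 2 ^ (1 / d) * a ∨ r ≤ 2 ^ (1 / d) * b := by
    rw [ha, hb, ← Real.mul_rpow (by norm_num) hts.le, ← Real.mul_rpow (by norm_num) hs.le]
    rcases le_total s (t - s) with h | h
    · exact Or.inl (Real.rpow_le_rpow ht.le (by linarith) hd')
    · exact Or.inr (Real.rpow_le_rpow ht.le (by linarith) hd')
  have hqa : Integrable fun y : EuclideanSpace ℝ (Fin N) => stableProfile N θ a ‖x - y‖ :=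
    (integrable_stableProfile hθ0 ha0).comp_sub_left x
  have hqb : Integrable fun y : EuclideanSpace ℝ (Fin N) => stableProfile N θ b ‖y‖ :=
    integrable_stableProfile hθ0 hb0
  -- Positivity, invisible in the oscillating Fourier integral, comes from the lower profile bound.
  have hnonneg : ∀ (z : EuclideanSpace ℝ (Fin N)) (τ : ℝ), 0 < τ → 0 ≤ majorantKernel d θ z τ :=
    fun z τ hτ => (mul_pos hc (stableProfile_pos N θ (by positivity) (norm_nonneg z))).le.trans
      (hK z τ hτ).1
  have hE : Integrable fun y : EuclideanSpace ℝ (Fin N) =>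
      C ^ 2 * (A * stableProfile N θ r ‖x‖ *
        (stableProfile N θ a ‖x - y‖ + stableProfile N θ b ‖y‖)) :=
    ((hqa.add hqb).const_mul _).const_mul _
  have hle : ∀ y : EuclideanSpace ℝ (Fin N),
      majorantKernel d θ (x - y) (t - s) * majorantKernel d θ y s ≤
        C ^ 2 * (A * stableProfile N θ r ‖x‖ *
          (stableProfile N θ a ‖x - y‖ + stableProfile N θ b ‖y‖)) := by
    intro y
    calc _ ≤ (C * stableProfile N θ a ‖x - y‖) * (C * stableProfile N θ b ‖y‖) :=
          mul_le_mul (hK _ _ hts).2 (hK _ _ hs).2 (hnonneg _ _ hs)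
            (mul_pos hC (stableProfile_pos N θ ha0 (norm_nonneg _))).le
      _ = C ^ 2 * (stableProfile N θ a ‖x - y‖ * stableProfile N θ b ‖y‖) := by ring
      _ ≤ _ := mul_le_mul_of_nonneg_left
          (stableProfile_mul_le hθ0 ha0 hb0 har hbr (by positivity) hor x y) (by positivity)
  have hint : Integrable fun y : EuclideanSpace ℝ (Fin N) =>
      majorantKernel d θ (x - y) (t - s) * majorantKernel d θ y s := by
    refine hE.mono' ?_ (ae_of_all _ fun y => ?_)
    · exact (((measurable_fracHeatKernel θ _).comp (measurable_const.sub measurable_id)).mul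
        (measurable_fracHeatKernel θ _)).aestronglyMeasurable
    · rw [Real.norm_of_nonneg (mul_nonneg (hnonneg _ _ hts) (hnonneg _ _ hs))]
      exact hle y
  refine ⟨hint, ?_⟩
  have hq := stableProfile_pos N θ hr0 (norm_nonneg x)
  have hla : ∫ y : EuclideanSpace ℝ (Fin N), stableProfile N θ a ‖x - y‖ = J := by
    rw [integral_sub_left_eq_self (fun y : EuclideanSpace ℝ (Fin N) => stableProfile N θ a ‖y‖),
      integral_stableProfile θ ha0]
  calc _ ≤ C ^ 2 * (A * stableProfile N θ r ‖x‖ * (J + J)) := by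
        refine (integral_mono hint hE hle).trans_eq ?_
        rw [integral_const_mul, integral_const_mul, integral_add hqa hqb, hla,
          integral_stableProfile θ hb0]
    _ ≤ C ^ 2 * A * (2 * J + 1) * stableProfile N θ r ‖x‖ := by
        have : 0 < C ^ 2 * A * stableProfile N θ r ‖x‖ := by positivity
        nlinarith
    _ = C ^ 2 * A * (2 * J + 1) / c * (c * stableProfile N θ r ‖x‖) := by field_simp
    _ ≤ _ := by
        gcongr
        exact (hK x t ht).1

theorem ConditionG.gradNorm_le_majorantKernel {N : ℕ} (hN : 1 ≤ N) {ℓ m : ℕ} {d L : ℝ} {T : EReal}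
    {G : EuclideanSpace ℝ (Fin N) → EuclideanSpace ℝ (Fin N) → ℝ → ℝ}
    (hG : ConditionG ℓ m d L T G) {θ : ℝ} (hθ0 : 0 < θ) (hθ2 : θ < 2) (hθL : θ ≤ L)
    {j : ℕ} (hj : j ≤ ℓ + m) :
    ∃ c : ℝ, 0 < c ∧
      ∀ (x y : EuclideanSpace ℝ (Fin N)) (t : ℝ), 0 < t → (t : EReal) < T →
        gradNorm j (fun z => G z y t) x ≤
          c * t ^ (-((j : ℝ) / d)) * majorantKernel d θ (x - y) t := by
  obtain ⟨c, _, hc, _, hK⟩ := majorantKernel_bounds hN d hθ0 hθ2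
  obtain ⟨C, hC, hb⟩ := hG.bound
  refine ⟨C / c, by positivity, fun x y t ht htT => (hb j hj x y t ht htT).trans ?_⟩
  have hρ : 0 < t ^ (1 / d) := by positivity
  have e1 : t ^ (-((N + j : ℝ) / d)) = t ^ (-((j : ℝ) / d)) * ((t ^ (1 / d)) ^ N)⁻¹ := by
    rw [← Real.rpow_natCast, ← Real.rpow_mul ht.le, ← Real.rpow_neg ht.le, ← Real.rpow_add ht]
    congr 1; ring
  have e2 : t ^ (-(1 / d)) * ‖x - y‖ = ‖(t ^ (1 / d))⁻¹ • (x - y)‖ := by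
    rw [norm_smul, norm_inv, Real.norm_of_nonneg hρ.le, Real.rpow_neg ht.le]
  calc _ ≤ C * t ^ (-((N + j : ℝ) / d)) *
        (1 + t ^ (-(1 / d)) * ‖x - y‖) ^ (-(N + θ)) := by
        gcongr ?_ * ?_
        -- The base is at least 1 and -N-L-j ≤ -(N+θ) because θ ≤ L and j ≥ 0: the extra spatial
        -- decay is discarded.
        refine Real.rpow_le_rpow_of_exponent_le ?_ ?_
        · rw [e2]; linarith [norm_nonneg ((t ^ (1 / d))⁻¹ • (x - y))]
        · linarith [(Nat.cast_nonneg j : (0 : ℝ) ≤ j)]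
    _ = C / c * t ^ (-((j : ℝ) / d)) * (c * stableProfile N θ (t ^ (1 / d)) ‖x - y‖) := by
        rw [stableProfile_eq_scaling θ _ hρ, e1, e2]
        field_simp
    _ ≤ _ := by
        gcongr
        exact (hK _ t ht).1

theorem theorem1p1 {N : ℕ} (hN : 1 ≤ N) (ℓ m : ℕ) (d L : ℝ) (T : EReal)
    (G : EuclideanSpace ℝ (Fin N) → EuclideanSpace ℝ (Fin N) → ℝ → ℝ)
    (hG : ConditionG ℓ m d L T G)
    (θ : ℝ) (hθ0 : 0 < θ) (hθ2 : θ < 2) (hθ : θ ≤ min d L) :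
    (∀ j : ℕ, j ≤ ℓ + m → ∃ c : ℝ, 0 < c ∧
      ∀ (x y : EuclideanSpace ℝ (Fin N)) (t : ℝ), 0 < t → (t : EReal) < T →
        gradNorm j (fun z => G z y t) x ≤ c * t ^ (-((j : ℝ) / d)) * majorantKernel d θ (x - y) t) ∧
    (∃ C : ℝ, 0 < C ∧ ∀ (x : EuclideanSpace ℝ (Fin N)) (s t : ℝ), 0 < s → s < t →
      Integrable (fun y => majorantKernel d θ (x - y) (t - s) * majorantKernel d θ y s) ∧
      ∫ y, majorantKernel d θ (x - y) (t - s) * majorantKernel d θ y s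
        ≤ C * majorantKernel d θ x t) :=
  ⟨fun _ hj => hG.gradNorm_le_majorantKernel hN hθ0 hθ2 (hθ.trans (min_le_right _ _)) hj,
    exists_majorantKernel_convolution_le hN (hθ0.trans_le (hθ.trans (min_le_left _ _))) hθ0 hθ2⟩
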